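/- Let $t\ge 0$ and $k\ge 2t$ be fixed integers. Let $V$ be a finite set with $v=|V|\ge 2t$. For $0\le i\le t$ put $\xi_i=\binom{v-t-i}{k-t-i}$, and let $M$ be the real matrix, with rows and columns indexed by the $t$-element subsets of $V$, given by $M(T,U)=\xi_{|T\setminus U|}$. For $0\le i,j\le t$ let $$P_{ij}=\sum_{s=0}^{i}(-1)^{i-s}\binom{t-s}{i-s}\binom{t-j}{s}\binom{v-t+s-j}{s}$$ (the entries of the first eigenmatrix of the Johnson scheme $J(t,v)$), and put $$\theta_j=\sum_{i=0}^{t}\xi_iP_{ij},\qquad m_j=\binom{v}{j}-\binom{v}{j-1},$$ where $\binom{v}{-1}=0$. (1) The eigenvalues of $M$ are exactly $\theta_0,\dots,\theta_t$, each $\theta_j$ with multiplicity $m_j$. That is, the characteristic polynomial of $M$ is $\prod_{j=0}^{t}(x-\theta_j)^{m_j}$, and for every real $\mu$ the space $\ker(M-\mu I)$ has dimension $\sum_{j:\theta_j=\mu}m_j$. (2) For each fixed $j$ with $0\le j\le t$, as $v\to\infty$, $$\theta_j=\binom{k-j}{t-j}\frac{v^{k-t}}{(k-t)!}+o(v^{k-t}),$$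 and $\theta_j$ has exact order $v^{k-t}$, i.e. $\theta_j=\Theta(v^{k-t})$. (3) There is $v_0$, depending only on $t$ and $k$, such that for all $v\ge v_0$ we have $\theta_0>\theta_1>\dots>\theta_t$. In particular the $\theta_j$ are then distinct reals, the eigenspace of $\theta_j$ has dimension exactly $m_j$, and $\theta_t$ is the least eigenvalue of $M$. -/

import Mathlib

namespace JohnsonCoverage

/-- The numbers `ξ_i = binom (v - t - i) (k - t - i)`, used only for `i ≤ t`, `2 t ≤ k`, `2 t ≤ v`,
where no subtraction truncates. -/
def xi (v t k i : ℕ) : ℕ := (v - t - i).choose (k - t - i)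

/-- The `t`-element subsets of `V`. -/
abbrev TSubset (V : Type*) (t : ℕ) : Type _ := {T : Finset V // T.card = t}

/-- The real matrix `M`, indexed by the `t`-subsets of the finite set `V`, with entries
`M(T, U) = ξ_{|T \ U|}` where `v = |V|`. -/
def coverageMatrix (V : Type*) [Fintype V] [DecidableEq V] (t k : ℕ) :
    Matrix (TSubset V t) (TSubset V t) ℝ :=
  Matrix.of fun T U => (xi (Fintype.card V) t k (T.1 \ U.1).card : ℝ)

/-- The entries `P_{ij}` of the first eigenmatrix of the Johnson scheme `J(t, v)`,
used only for `i, j ≤ t` and `2 t ≤ v`, where no subtraction truncates. -/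
def eigenP (v t i j : ℕ) : ℝ :=
  ∑ s ∈ Finset.range (i + 1), (-1 : ℝ) ^ (i - s) * ((t - s).choose (i - s) : ℝ) *
    ((t - j).choose s : ℝ) * ((v - t + s - j).choose s : ℝ)

/-- `θ_j = ∑_{i=0}^t ξ_i P_{ij}`. -/
def theta (v t k j : ℕ) : ℝ :=
  ∑ i ∈ Finset.range (t + 1), (xi v t k i : ℝ) * eigenP v t i j

/-- `m_j = binom v j - binom v (j - 1)`, with `binom v (-1) = 0`. For `j ≤ t` and `2 t ≤ v`
the difference is positive, so the subtraction of natural numbers is the ordinary one. -/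
def multiplicity (v j : ℕ) : ℕ :=
  v.choose j - (if j = 0 then 0 else v.choose (j - 1))

end JohnsonCoverage

/-!
A function on `j`-subsets is harmonic if, for every set `S` with fewer than `j` elements, its sum
over the `j`-subsets containing `S` vanishes. Let `W a b` be the inclusion matrix of `a`-subsets
in `b`-subsets. By Vandermonde's identity the lift `(W j n)ᵀ f` of a harmonic `f` satisfies
`W r n (W j n)ᵀ f = binom (v - r - j) (n - r) (W j r)ᵀ f`, so the lifts of `f` to `t`-subsets are
eigenvectors of every `(W r t)ᵀ (W r t)` and every `(W t n) (W t n)ᵀ`. Binomial inversion writes the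
associate matrices of the Johnson scheme in terms of the former, which produces the numbers `P i j`.
Harmonic functions on `j`-subsets have dimension at least `m j`, the lifts for different `j` lie in
different eigenspaces of `(W t (t + 1)) (W t (t + 1))ᵀ`, and `∑ m j = binom v t`, so these
eigenvectors span.

Since moreover `M = (W t k) (W t k)ᵀ`, evaluating `M` on the same eigenvectors a second time gives
`θ j = binom (k - j) (k - t) * binom (v - t - j) (k - t)`, from which the asymptotics and the order
of the eigenvalues are read off.
-/

namespace JohnsonCoverage

open Finset Matrix

section Binomial

theorem choose_lt_choose_succ {n k : ℕ} (h : 2 * k + 1 < n) : n.choose k < n.choose (k + 1) := by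
  refine lt_of_mul_lt_mul_right ?_ (Nat.zero_le (k + 1))
  rw [Nat.choose_succ_right_eq]
  exact Nat.mul_lt_mul_of_pos_left (by lia) (Nat.choose_pos (by lia))

theorem choose_lt_choose_left {m n c : ℕ} (hc : 0 < c) (hcn : c ≤ n) (hmn : m < n) :
    m.choose c < n.choose c := by
  obtain ⟨c, rfl⟩ := Nat.exists_eq_add_one.mpr hc
  obtain ⟨n, rfl⟩ := Nat.exists_eq_add_one.mpr (hc.trans_le hcn)
  calc m.choose (c + 1) ≤ n.choose (c + 1) := Nat.choose_le_choose _ (by lia)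
    _ < n.choose c + n.choose (c + 1) := by
      have : 0 < n.choose c := Nat.choose_pos (by lia)
      lia
    _ = (n + 1).choose (c + 1) := (Nat.choose_succ_succ' n c).symm

theorem alternating_sum_range_choose_of_le {b n : ℕ} (h : b ≤ n) :
    ∑ m ∈ range (n + 1), (-1 : ℤ) ^ m * b.choose m = if b = 0 then 1 else 0 := by
  rw [← Int.alternating_sum_range_choose]
  refine (sum_subset (range_subset_range.mpr (by lia)) fun m _ hm => ?_).symm
  rw [Nat.choose_eq_zero_of_lt (by simpa using hm), Nat.cast_zero, mul_zero]

theorem alternating_sum_choose_mul_choose {a b n : ℕ} (h : b ≤ a + n) :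
    ∑ m ∈ range (n + 1), (-1 : ℤ) ^ m * (a + m).choose m * b.choose (a + m) =
      if b = a then 1 else 0 := by
  have factor (m : ℕ) : (-1 : ℤ) ^ m * (a + m).choose m * b.choose (a + m) =
      b.choose a * ((-1) ^ m * (b - a).choose m) := by
    have := Nat.choose_mul (n := b) (Nat.le_add_right a m)
    rw [Nat.choose_symm_add, Nat.add_sub_cancel_left] at this
    have cast : (b.choose (a + m) * (a + m).choose m : ℤ) = b.choose a * (b - a).choose m := by
      exact_mod_cast this
    linear_combination (-1) ^ m * cast
  simp only [factor, ← mul_sum, alternating_sum_range_choose_of_le (show b - a ≤ n by lia)]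
  rcases lt_trichotomy b a with hba | rfl | hab
  · simp [Nat.choose_eq_zero_of_lt hba, hba.ne]
  · simp
  · simp [hab.ne', Nat.sub_ne_zero_of_lt hab]

theorem multiplicity_pos {v j : ℕ} (h : 2 * j ≤ v) : 0 < multiplicity v j := by
  cases j with
  | zero => simp [multiplicity]
  | succ j => simpa [multiplicity] using choose_lt_choose_succ (by lia)

theorem sum_multiplicity {v t : ℕ} (h : 2 * t ≤ v) :
    ∑ j ∈ range (t + 1), multiplicity v j = v.choose t := by
  induction t with
  | zero => simp [multiplicity]
  | succ t ih =>
    rw [sum_range_succ, ih (by lia), multiplicity, if_neg t.succ_ne_zero, Nat.add_sub_cancel]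
    exact Nat.add_sub_of_le (choose_lt_choose_succ (by lia)).le

end Binomial

section LinearAlgebra

variable {K M ι : Type*} [Field K] [AddCommGroup M] [Module K M] [Fintype ι]

theorem exists_basis_of_iSupIndep [FiniteDimensional K M] {p : ι → Submodule K M}
    (hp : iSupIndep p) {m : ι → ℕ} (hm : ∀ i, m i ≤ Module.finrank K (p i))
    (hsum : ∑ i, m i = Module.finrank K M) :
    ∃ b : Module.Basis (Σ i, Fin (m i)) K M, ∀ x, b x ∈ p x.1 := by
  classical
  choose w hw using fun i => exists_linearIndependent_of_le_finrank (hm i)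
  have hli := (DFinsupp.linearIndependent_single w hw).map' _
    (LinearMap.ker_eq_bot.mpr hp.dfinsupp_lsum_injective)
  refine ⟨basisOfLinearIndependentOfCardEqFinrank' _ hli (by simpa using hsum), fun x => ?_⟩
  simp

variable [DecidableEq ι]

theorem eq_toLin_diagonal {R N : Type*} [CommRing R] [AddCommGroup N] [Module R N]
    {f : N →ₗ[R] N} (b : Module.Basis ι R N) {d : ι → R} (h : ∀ i, f (b i) = d i • b i) :
    f = toLin b b (diagonal d) :=
  b.ext fun i => by simp [h, diagonal]

theorem charpoly_toLin_diagonal {R N : Type*} [CommRing R] [AddCommGroup N] [Module R N]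
    [Module.Free R N] [Module.Finite R N] (b : Module.Basis ι R N) (d : ι → R) :
    (toLin b b (diagonal d)).charpoly = ∏ i, (Polynomial.X - Polynomial.C (d i)) := by
  rw [← LinearMap.charpoly_toMatrix _ b, LinearMap.toMatrix_toLin, charpoly_diagonal]

theorem finrank_eigenspace_toLin_diagonal [DecidableEq K] (b : Module.Basis ι K M) (d : ι → K)
    (μ : K) : Module.finrank K (Module.End.eigenspace (toLin b b (diagonal d)) μ) =
      #{i | d i = μ} := by
  have := b.finiteDimensional_of_finite
  rw [← maxGenEigenspace_toLin_diagonal_eq_eigenspace, LinearMap.finrank_maxGenEigenspace_eq,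
    charpoly_toLin_diagonal, ← Polynomial.count_roots, prod_eq_multiset_prod,
    ← Function.comp_def (fun a => Polynomial.X - Polynomial.C a) d, ← Multiset.map_map,
    Polynomial.roots_multiset_prod_X_sub_C, Multiset.count_map]
  simp only [eq_comm, card_def, filter_val]

end LinearAlgebra

section Inclusion

/-- The inclusion matrix `W a b` of `a`-subsets versus `b`-subsets of `V`. -/
def inclusionMatrix (R V : Type*) [Zero R] [One R] [DecidableEq V] (a b : ℕ) :
    Matrix (TSubset V a) (TSubset V b) R :=
  Matrix.of fun S T => if S.1 ⊆ T.1 then 1 else 0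

theorem sum_tSubset_boole {R V : Type*} [AddCommMonoidWithOne R] [Fintype V] (p : Finset V → Prop)
    [DecidablePred p] (n : ℕ) :
    ∑ U : TSubset V n, (if p U.1 then (1 : R) else 0) = #{U ∈ powersetCard n univ | p U} := by
  rw [← sum_boole]
  exact (sum_subtype (powersetCard n univ) (by simp) fun U => if p U then (1 : R) else 0).symm

variable {R V : Type*} [DecidableEq V]

theorem inclusionMatrix_self [Zero R] [One R] (j : ℕ) : inclusionMatrix R V j j = 1 := by
  ext S T
  have : S.1 ⊆ T.1 ↔ S = T :=
    ⟨fun h => Subtype.ext (eq_of_subset_of_card_le h (by rw [S.2, T.2])), fun h => h ▸ Subset.rfl⟩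
  simp only [inclusionMatrix, of_apply, one_apply, this]

theorem inclusionMatrix_eq_zero [Zero R] [One R] {a b : ℕ} (h : b < a) :
    inclusionMatrix R V a b = 0 := by
  ext S T
  have : ¬S.1 ⊆ T.1 := fun hST => by
    have := card_le_card hST
    lia
  simp only [inclusionMatrix, of_apply, if_neg this, Matrix.zero_apply]

variable [Fintype V]

theorem card_filter_powersetCard_interval {S T : Finset V} {n : ℕ} (hST : S ⊆ T) (hn : n ≤ #T) :
    #{U ∈ powersetCard n (univ : Finset V) | S ⊆ U ∧ U ⊆ T} = (#T - #S).choose (#T - n) := by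
  have hfilter : {U ∈ powersetCard n (univ : Finset V) | S ⊆ U ∧ U ⊆ T} =
      {U ∈ powersetCard n T | S ⊆ U} := by grind
  rw [hfilter]
  rcases le_or_gt #S n with hS | hS
  · rw [card_filter_powersetCard_subset _ _ _ hST hS]
    exact Nat.choose_symm_of_eq_add (by lia)
  · rw [Nat.choose_eq_zero_of_lt (by have := card_le_card hST; lia), card_eq_zero,
      filter_eq_empty_iff]
    intro U hU hSU
    have := card_le_card hSU
    have := (mem_powersetCard.mp hU).2
    lia

section Semiring

variable [CommSemiring R]

theorem inclusionMatrix_mul (a : ℕ) {r b : ℕ} (h : r ≤ b) :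
    inclusionMatrix R V a r * inclusionMatrix R V r b =
      ((b - a).choose (b - r) : R) • inclusionMatrix R V a b := by
  ext S T
  simp only [inclusionMatrix, mul_apply, Matrix.smul_apply, of_apply, smul_eq_mul,
    ite_zero_mul_ite_zero, mul_one]
  rw [sum_tSubset_boole fun U => S.1 ⊆ U ∧ U ⊆ T.1, mul_boole]
  split_ifs with hST
  · rw [card_filter_powersetCard_interval hST (T.2.symm ▸ h), S.2, T.2]
  · rw [filter_false_of_mem fun U _ hU => hST (hU.1.trans hU.2), card_empty, Nat.cast_zero]

theorem inclusionMatrix_mul_transpose_apply {r j n : ℕ} (A : TSubset V r) (B : TSubset V j) :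
    (inclusionMatrix R V r n * (inclusionMatrix R V j n)ᵀ) A B =
      #{U ∈ powersetCard n univ | A.1 ∪ B.1 ⊆ U} := by
  simp only [inclusionMatrix, mul_apply, of_apply, transpose_apply, ite_zero_mul_ite_zero, mul_one,
    union_subset_iff]
  exact sum_tSubset_boole (fun U => A.1 ⊆ U ∧ B.1 ⊆ U) n

theorem transpose_inclusionMatrix_mul_apply {a r j : ℕ} (A : TSubset V r) (B : TSubset V j) :
    ((inclusionMatrix R V a r)ᵀ * inclusionMatrix R V a j) A B = (#(A.1 ∩ B.1)).choose a := by
  simp only [inclusionMatrix, mul_apply, of_apply, transpose_apply, ite_zero_mul_ite_zero, mul_one]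
  rw [sum_tSubset_boole fun U => U ⊆ A.1 ∧ U ⊆ B.1, ← card_powersetCard]
  congr 2
  grind

theorem inclusionMatrix_mul_transpose {r j n : ℕ} (hn : n ≤ Fintype.card V)
    (hrj : r + j ≤ Fintype.card V) :
    inclusionMatrix R V r n * (inclusionMatrix R V j n)ᵀ =
      ∑ p ∈ antidiagonal (Fintype.card V - n), ((Fintype.card V - r - j).choose p.2 : R) •
        ((inclusionMatrix R V p.1 r)ᵀ * inclusionMatrix R V p.1 j) := by
  ext A B
  have hcard : Fintype.card V - #(A.1 ∪ B.1) = #(A.1 ∩ B.1) + (Fintype.card V - r - j) := by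
    have := card_union_add_card_inter A.1 B.1
    lia
  have hcount := card_filter_powersetCard_interval (subset_univ (A.1 ∪ B.1)) (n := n) (by simpa)
  simp only [subset_univ, and_true, card_univ, hcard] at hcount
  rw [inclusionMatrix_mul_transpose_apply, hcount, Nat.add_choose_eq]
  simp only [Matrix.sum_apply, Matrix.smul_apply, transpose_inclusionMatrix_mul_apply, smul_eq_mul,
    Nat.cast_sum, Nat.cast_mul, mul_comm]

end Semiring

end Inclusion

section Harmonic

variable {K R V : Type*} [Field K] [CharZero K] [CommRing R] [Fintype V] [DecidableEq V]
  {r j t n : ℕ}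

variable (R V j) in
/-- The harmonic functions on `j`-subsets of `V`: for each set `S` of fewer than `j` elements, the
values on the `j`-subsets containing `S` sum to zero. -/
def harmonic : Submodule R (TSubset V j → R) :=
  ⨅ a < j, LinearMap.ker (inclusionMatrix R V a j).mulVecLin

theorem mem_harmonic {f : TSubset V j → R} :
    f ∈ harmonic R V j ↔ ∀ a < j, inclusionMatrix R V a j *ᵥ f = 0 := by
  simp only [harmonic, Submodule.mem_iInf, LinearMap.mem_ker, mulVecLin_apply]

theorem inclusionMatrix_mulVec_eq_zero {a : ℕ} (ha : a ≠ j) {f : TSubset V j → R}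
    (hf : f ∈ harmonic R V j) : inclusionMatrix R V a j *ᵥ f = 0 := by
  rcases ha.lt_or_gt with h | h
  · exact mem_harmonic.mp hf a h
  · rw [inclusionMatrix_eq_zero h, zero_mulVec]

/-- The lift of a function `f` on `j`-subsets to `t`-subsets, whose value at `T` is the sum of `f`
over the `j`-subsets of `T`. -/
def lift (t : ℕ) : (TSubset V j → R) →ₗ[R] (TSubset V t → R) :=
  (inclusionMatrix R V j t)ᵀ.mulVecLin

theorem lift_self (f : TSubset V j → R) : lift j f = f := by
  rw [lift, inclusionMatrix_self, transpose_one, mulVecLin_one, LinearMap.id_apply]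

theorem transpose_inclusionMatrix_mulVec_lift (htn : t ≤ n) (f : TSubset V j → R) :
    (inclusionMatrix R V t n)ᵀ *ᵥ lift t f = ((n - j).choose (n - t) : R) • lift n f := by
  simp only [lift, mulVecLin_apply]
  rw [mulVec_mulVec, ← transpose_mul, inclusionMatrix_mul _ htn, transpose_smul, smul_mulVec]

theorem inclusionMatrix_mulVec_lift (hrn : r ≤ n) (hrj : r + j ≤ Fintype.card V)
    {f : TSubset V j → R} (hf : f ∈ harmonic R V j) :
    inclusionMatrix R V r n *ᵥ lift n f =
      ((Fintype.card V - r - j).choose (n - r) : R) • lift r f := by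
  rcases lt_or_ge (Fintype.card V) n with hn | hn
  · have : IsEmpty (TSubset V n) := ⟨fun U => by
      have := card_le_univ U.1
      lia⟩
    rw [Nat.choose_eq_zero_of_lt (by lia), Nat.cast_zero, zero_smul,
      Subsingleton.elim (lift n f) 0, mulVec_zero]
  simp only [lift, mulVecLin_apply]
  rw [mulVec_mulVec, inclusionMatrix_mul_transpose hn hrj, sum_mulVec]
  simp only [smul_mulVec, ← mulVec_mulVec]
  rcases le_or_gt j (Fintype.card V - n) with hj | hj
  · rw [sum_eq_single_of_mem (j, Fintype.card V - n - j) (by simp; lia)]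
    · rw [inclusionMatrix_self, one_mulVec,
        Nat.choose_symm_of_eq_add (show Fintype.card V - r - j = _ + (n - r) by lia)]
    · intro p hp hne
      have hpn : p.1 + p.2 = Fintype.card V - n := HasAntidiagonal.mem_antidiagonal.mp hp
      have hpj : p.1 ≠ j := fun h => hne (Prod.ext h (by lia))
      rw [inclusionMatrix_mulVec_eq_zero hpj hf, mulVec_zero, smul_zero]
  · rw [Nat.choose_eq_zero_of_lt (by lia), Nat.cast_zero, zero_smul]
    refine sum_eq_zero fun p hp => ?_
    have hpn : p.1 + p.2 = Fintype.card V - n := HasAntidiagonal.mem_antidiagonal.mp hp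
    have hpj : p.1 ≠ j := by lia
    rw [inclusionMatrix_mulVec_eq_zero hpj hf, mulVec_zero, smul_zero]

theorem transpose_mul_inclusionMatrix_mulVec_lift (hrt : r ≤ t) (hrj : r + j ≤ Fintype.card V)
    {f : TSubset V j → R} (hf : f ∈ harmonic R V j) :
    ((inclusionMatrix R V r t)ᵀ * inclusionMatrix R V r t) *ᵥ lift t f =
      ((t - j).choose (t - r) * (Fintype.card V - r - j).choose (t - r) : R) • lift t f := by
  rw [← mulVec_mulVec, inclusionMatrix_mulVec_lift hrt hrj hf, mulVec_smul,
    transpose_inclusionMatrix_mulVec_lift hrt, smul_smul, mul_comm]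

theorem inclusionMatrix_mul_transpose_mulVec_lift (htn : t ≤ n) (htj : t + j ≤ Fintype.card V)
    {f : TSubset V j → R} (hf : f ∈ harmonic R V j) :
    (inclusionMatrix R V t n * (inclusionMatrix R V t n)ᵀ) *ᵥ lift t f =
      ((n - j).choose (n - t) * (Fintype.card V - t - j).choose (n - t) : R) • lift t f := by
  rw [← mulVec_mulVec, transpose_inclusionMatrix_mulVec_lift htn, mulVec_smul,
    inclusionMatrix_mulVec_lift htn htj hf, smul_smul]

theorem injOn_lift_harmonic [IsDomain R] [CharZero R] (hjt : j ≤ t) (ht : t + j ≤ Fintype.card V) :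
    Set.InjOn (lift t) (harmonic R V j : Set (TSubset V j → R)) := by
  rw [← LinearMap.disjoint_ker_iff_injOn, LinearMap.disjoint_ker]
  intro f hf hzero
  have := inclusionMatrix_mulVec_lift hjt (by lia) hf
  rw [hzero, mulVec_zero, lift_self] at this
  refine (smul_eq_zero.mp this.symm).resolve_left ?_
  exact Nat.cast_ne_zero.mpr (Nat.choose_pos (by lia)).ne'

variable (K V j) in
theorem ker_inclusionMatrix_le_harmonic :
    LinearMap.ker (inclusionMatrix K V j (j + 1)).mulVecLin ≤ harmonic K V (j + 1) := by
  intro f hf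
  rw [LinearMap.mem_ker, mulVecLin_apply] at hf
  refine mem_harmonic.mpr fun a ha => ?_
  have := congrArg (· *ᵥ f) (inclusionMatrix_mul (R := K) (V := V) a j.le_succ)
  simp only [← mulVec_mulVec, hf, mulVec_zero, smul_mulVec] at this
  refine (smul_eq_zero.mp this.symm).resolve_left ?_
  exact Nat.cast_ne_zero.mpr (Nat.choose_pos (by lia)).ne'

variable (K V j) in
theorem multiplicity_le_finrank_harmonic :
    multiplicity (Fintype.card V) j ≤ Module.finrank K (harmonic K V j) := by
  cases j with
  | zero =>
    have : harmonic K V 0 = ⊤ := by simp [harmonic]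
    rw [this, finrank_top, Module.finrank_fintype_fun_eq_card, Fintype.card_finset_len]
    simp [multiplicity]
  | succ j =>
    have hker := Submodule.finrank_mono (ker_inclusionMatrix_le_harmonic K V j)
    have hsum := (inclusionMatrix K V j (j + 1)).mulVecLin.finrank_range_add_finrank_ker
    have hrange := (LinearMap.range (inclusionMatrix K V j (j + 1)).mulVecLin).finrank_le
    simp only [Module.finrank_fintype_fun_eq_card, Fintype.card_finset_len] at hsum hrange
    simp only [multiplicity, Nat.add_one_ne_zero, if_false, Nat.add_sub_cancel]
    lia

theorem iSupIndep_lift_harmonic (ht : 2 * t ≤ Fintype.card V) :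
    iSupIndep fun j : Fin (t + 1) => (harmonic K V j).map (lift t) := by
  let d (j : Fin (t + 1)) : ℕ := (t + 1 - j) * (Fintype.card V - t - j)
  have hd : StrictAnti d := fun i j hij => by
    have : (i : ℕ) < j := hij
    exact Nat.mul_lt_mul'' (by lia) (by lia)
  refine ((Module.End.eigenspaces_iSupIndep (inclusionMatrix K V t (t + 1) *
    (inclusionMatrix K V t (t + 1))ᵀ).mulVecLin).comp
      (Nat.cast_injective.comp hd.injective)).mono fun j => ?_
  rintro _ ⟨f, hf, rfl⟩
  rw [Function.comp_apply, Module.End.mem_eigenspace_iff, mulVecLin_apply,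
    inclusionMatrix_mul_transpose_mulVec_lift t.le_succ (by lia) hf]
  simp [d]

theorem multiplicity_le_finrank_lift_harmonic (hjt : j ≤ t) (ht : t + j ≤ Fintype.card V) :
    multiplicity (Fintype.card V) j ≤ Module.finrank K ((harmonic K V j).map (lift t)) := by
  have hinj : Function.Injective ((lift t).domRestrict (harmonic K V j)) :=
    Set.injOn_iff_injective.mp (injOn_lift_harmonic hjt ht)
  rw [← LinearMap.range_domRestrict, LinearMap.finrank_range_of_inj hinj]
  exact multiplicity_le_finrank_harmonic K V j

end Harmonic

section JohnsonScheme

/-- The `i`-th associate matrix of the Johnson scheme on the `t`-subsets of `V`. -/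
def associateMatrix (R V : Type*) [Zero R] [One R] [DecidableEq V] (t i : ℕ) :
    Matrix (TSubset V t) (TSubset V t) R :=
  of fun T U => if #(T.1 \ U.1) = i then 1 else 0

/-- The general element `∑ i, ξ i • A i` of the Bose–Mesner algebra of the Johnson scheme, where
`A i` is the `i`-th associate matrix. -/
def johnsonMatrix {R : Type*} (V : Type*) [DecidableEq V] (t : ℕ) (ξ : ℕ → R) :
    Matrix (TSubset V t) (TSubset V t) R :=
  of fun T U => ξ #(T.1 \ U.1)

/-- The eigenvalue of `johnsonMatrix V t ξ`, where `v = |V|`, on the lifts of the harmonic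
functions on `j`-subsets. -/
noncomputable def johnsonEigenvalue (v t : ℕ) (ξ : ℕ → ℝ) (j : ℕ) : ℝ :=
  ∑ i ∈ range (t + 1), ξ i * eigenP v t i j

variable {R V : Type*} [DecidableEq V] {t i j : ℕ}

theorem johnsonMatrix_eq_sum [NonAssocSemiring R] (ξ : ℕ → R) :
    johnsonMatrix V t ξ = ∑ i ∈ range (t + 1), ξ i • associateMatrix R V t i := by
  ext T U
  have : #(T.1 \ U.1) < t + 1 := Nat.lt_succ_of_le ((card_le_card sdiff_subset).trans T.2.le)
  simp [johnsonMatrix, associateMatrix, Matrix.sum_apply, this]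

variable [Fintype V]

theorem associateMatrix_eq_sum [CommRing R] (hi : i ≤ t) :
    associateMatrix R V t i = ∑ s ∈ range (i + 1), ((-1) ^ (i - s) * (t - s).choose (i - s) : R) •
      ((inclusionMatrix R V (t - s) t)ᵀ * inclusionMatrix R V (t - s) t) := by
  ext T U
  have hcard : #(T.1 \ U.1) + #(T.1 ∩ U.1) = t :=
    (card_sdiff_add_card_inter T.1 U.1).trans T.2
  have hinv := congrArg (Int.cast : ℤ → R) (alternating_sum_choose_mul_choose
    (show #(T.1 ∩ U.1) ≤ t - i + i by lia))
  push_cast at hinv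
  simp only [associateMatrix, of_apply, Matrix.sum_apply, Matrix.smul_apply, smul_eq_mul,
    transpose_inclusionMatrix_mul_apply, show #(T.1 \ U.1) = i ↔ #(T.1 ∩ U.1) = t - i by lia]
  rw [← hinv, ← sum_range_reflect]
  refine sum_congr rfl fun s hs => ?_
  have hsi : s ≤ i := mem_range_succ_iff.mp hs
  rw [show t - i + (i + 1 - 1 - s) = t - s by lia, Nat.add_sub_cancel]

theorem associateMatrix_mulVec_lift (ht : 2 * t ≤ Fintype.card V) (hi : i ≤ t) (hj : j ≤ t)
    {f : TSubset V j → ℝ} (hf : f ∈ harmonic ℝ V j) :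
    associateMatrix ℝ V t i *ᵥ lift t f = eigenP (Fintype.card V) t i j • lift t f := by
  rw [associateMatrix_eq_sum hi, sum_mulVec, eigenP, sum_smul]
  refine sum_congr rfl fun s hs => ?_
  have hsi : s ≤ i := mem_range_succ_iff.mp hs
  rw [smul_mulVec, transpose_mul_inclusionMatrix_mulVec_lift (by lia) (by lia) hf, smul_smul,
    show t - (t - s) = s by lia,
    show Fintype.card V - (t - s) - j = Fintype.card V - t + s - j by lia]
  simp only [mul_assoc]

theorem johnsonMatrix_mulVec_lift (ht : 2 * t ≤ Fintype.card V) (ξ : ℕ → ℝ) (hj : j ≤ t)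
    {f : TSubset V j → ℝ} (hf : f ∈ harmonic ℝ V j) :
    johnsonMatrix V t ξ *ᵥ lift t f = johnsonEigenvalue (Fintype.card V) t ξ j • lift t f := by
  rw [johnsonMatrix_eq_sum, sum_mulVec, johnsonEigenvalue, sum_smul]
  refine sum_congr rfl fun i hi => ?_
  rw [smul_mulVec, associateMatrix_mulVec_lift ht (mem_range_succ_iff.mp hi) hj hf, smul_smul]

theorem exists_common_eigenbasis (ht : 2 * t ≤ Fintype.card V) :
    ∃ b : Module.Basis (Σ j : Fin (t + 1), Fin (multiplicity (Fintype.card V) j)) ℝ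
      (TSubset V t → ℝ), ∀ ξ, toLin' (johnsonMatrix V t ξ) =
        toLin b b (diagonal fun x => johnsonEigenvalue (Fintype.card V) t ξ x.1) := by
  have hsum : ∑ j : Fin (t + 1), multiplicity (Fintype.card V) j =
      Module.finrank ℝ (TSubset V t → ℝ) := by
    rw [Fin.sum_univ_eq_sum_range, sum_multiplicity ht, Module.finrank_fintype_fun_eq_card,
      Fintype.card_finset_len]
  obtain ⟨b, hb⟩ := exists_basis_of_iSupIndep (iSupIndep_lift_harmonic (K := ℝ) ht)
    (m := fun j => multiplicity (Fintype.card V) j)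
    (fun j => multiplicity_le_finrank_lift_harmonic (by lia) (by lia)) hsum
  refine ⟨b, fun ξ => eq_toLin_diagonal b fun x => ?_⟩
  obtain ⟨f, hf, hfx⟩ := hb x
  rw [← hfx, toLin'_apply, johnsonMatrix_mulVec_lift ht ξ (by lia) hf]

theorem charpoly_johnsonMatrix (ht : 2 * t ≤ Fintype.card V) (ξ : ℕ → ℝ) :
    (johnsonMatrix V t ξ).charpoly = ∏ j ∈ range (t + 1),
      (Polynomial.X - Polynomial.C (johnsonEigenvalue (Fintype.card V) t ξ j)) ^
        multiplicity (Fintype.card V) j := by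
  obtain ⟨b, hb⟩ := exists_common_eigenbasis ht
  rw [← charpoly_toLin', hb, charpoly_toLin_diagonal, Fintype.prod_sigma, prod_range]
  simp

theorem finrank_eigenspace_johnsonMatrix (ht : 2 * t ≤ Fintype.card V) (ξ : ℕ → ℝ) (μ : ℝ) :
    Module.finrank ℝ (Module.End.eigenspace (toLin' (johnsonMatrix V t ξ)) μ) =
      ∑ j ∈ range (t + 1) with johnsonEigenvalue (Fintype.card V) t ξ j = μ,
        multiplicity (Fintype.card V) j := by
  obtain ⟨b, hb⟩ := exists_common_eigenbasis ht
  rw [hb, finrank_eigenspace_toLin_diagonal, card_filter, Fintype.sum_sigma, sum_filter, sum_range]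
  simp [apply_ite]

theorem hasEigenvalue_johnsonMatrix_iff (ht : 2 * t ≤ Fintype.card V) (ξ : ℕ → ℝ) (μ : ℝ) :
    Module.End.HasEigenvalue (toLin' (johnsonMatrix V t ξ)) μ ↔
      ∃ j ≤ t, μ = johnsonEigenvalue (Fintype.card V) t ξ j := by
  obtain ⟨b, hb⟩ := exists_common_eigenbasis ht
  rw [hb, hasEigenvalue_toLin_diagonal_iff]
  constructor
  · rintro ⟨x, rfl⟩
    exact ⟨x.1, by lia, rfl⟩
  · rintro ⟨j, hj, rfl⟩
    exact ⟨⟨⟨j, by lia⟩, ⟨0, multiplicity_pos (by lia)⟩⟩, rfl⟩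

end JohnsonScheme

section Coverage

variable {V : Type*} [Fintype V] [DecidableEq V] {j t k v : ℕ}

theorem coverageMatrix_eq_mul_transpose (hk : 2 * t ≤ k) :
    coverageMatrix V t k = inclusionMatrix ℝ V t k * (inclusionMatrix ℝ V t k)ᵀ := by
  ext T U
  have hcard : #(T.1 ∪ U.1) = t + #(T.1 \ U.1) := by
    rw [← sdiff_union_self_eq_union, card_union_of_disjoint sdiff_disjoint, U.2, add_comm]
  have hle : #(T.1 \ U.1) ≤ t := (card_le_card sdiff_subset).trans T.2.le
  rw [inclusionMatrix_mul_transpose_apply,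
    card_filter_powersetCard_subset _ _ _ (subset_univ _) (by lia), card_univ, hcard,
    ← Nat.sub_sub, ← Nat.sub_sub]
  rfl

theorem theta_eq (hk : 2 * t ≤ k) (hv : 2 * t ≤ v) (hj : j ≤ t) :
    theta v t k j = (k - j).choose (k - t) * (v - t - j).choose (k - t) := by
  obtain ⟨w, hw, hne⟩ : ∃ w ∈ (harmonic ℝ (Fin v) j).map (lift t), w ≠ 0 := by
    refine Submodule.exists_mem_ne_zero_of_ne_bot (Submodule.one_le_finrank_iff.mp ?_)
    refine le_trans ?_ (multiplicity_le_finrank_lift_harmonic hj (by simp; lia))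
    exact multiplicity_pos (by simp; lia)
  obtain ⟨f, hf, rfl⟩ := hw
  have hscheme : coverageMatrix (Fin v) t k *ᵥ lift t f =
      theta (Fintype.card (Fin v)) t k j • lift t f :=
    johnsonMatrix_mulVec_lift (by simpa) (xi (Fintype.card (Fin v)) t k ·) hj hf
  have htk : t ≤ k := by lia
  have hgram := inclusionMatrix_mul_transpose_mulVec_lift htk (by simp; lia) hf
  rw [← coverageMatrix_eq_mul_transpose hk, hscheme, Fintype.card_fin] at hgram
  exact smul_left_injective ℝ hne hgram

theorem strictAntiOn_theta (hk : 2 * t ≤ k) (hv : k + t ≤ v) :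
    StrictAntiOn (theta v t k) (Set.Iic t) := by
  intro i hi j hj hij
  rw [Set.mem_Iic] at hi hj
  rw [theta_eq hk (by lia) hi, theta_eq hk (by lia) hj]
  have hlt : (k - j).choose (k - t) < (k - i).choose (k - t) :=
    choose_lt_choose_left (by lia) (by lia) (by lia)
  have hle : (v - t - j).choose (k - t) ≤ (v - t - i).choose (k - t) :=
    Nat.choose_le_choose _ (by lia)
  exact_mod_cast Nat.mul_lt_mul_of_lt_of_le hlt hle (Nat.choose_pos (by lia))

theorem finrank_eigenspace_coverageMatrix (hk : 2 * t ≤ k) (hV : k + t ≤ Fintype.card V)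
    (hj : j ≤ t) :
    Module.finrank ℝ (Module.End.eigenspace (toLin' (coverageMatrix V t k))
      (theta (Fintype.card V) t k j)) = multiplicity (Fintype.card V) j := by
  refine (finrank_eigenspace_johnsonMatrix (by lia) (xi (Fintype.card V) t k ·) _).trans ?_
  refine sum_eq_single_of_mem j (by simp [Nat.lt_succ_of_le hj]; rfl) fun i hi hne => ?_
  obtain ⟨hit, hij⟩ := mem_filter.mp hi
  exact absurd ((strictAntiOn_theta hk hV).injOn (mem_range_succ_iff.mp hit) hj hij) hne

theorem isLeast_eigenvalue_coverageMatrix (hk : 2 * t ≤ k) (hV : k + t ≤ Fintype.card V) :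
    IsLeast {μ : ℝ | Module.End.HasEigenvalue (toLin' (coverageMatrix V t k)) μ}
      (theta (Fintype.card V) t k t) := by
  have hspec := hasEigenvalue_johnsonMatrix_iff (V := V) (show 2 * t ≤ Fintype.card V by lia)
    (xi (Fintype.card V) t k ·)
  refine ⟨(hspec _).mpr ⟨t, le_rfl, rfl⟩, fun μ hμ => ?_⟩
  obtain ⟨j, hj, rfl⟩ := (hspec μ).mp hμ
  exact (strictAntiOn_theta hk hV).antitoneOn hj Set.self_mem_Iic hj

open Filter Asymptotics

theorem isEquivalent_choose_sub (n c : ℕ) :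
    (fun v : ℕ => ((v - c).choose n : ℝ)) ~[atTop] fun v : ℕ => (v : ℝ) ^ n / n.factorial := by
  have hsub : (fun v : ℕ => ((v - c : ℕ) : ℝ)) ~[atTop] fun v : ℕ => (v : ℝ) := by
    have : (fun v : ℕ => (v : ℝ) - c) ~[atTop] fun v : ℕ => (v : ℝ) :=
      IsEquivalent.refl.sub_isLittleO <| isLittleO_const_left.mpr <| Or.inr <|
        tendsto_norm_atTop_atTop.comp tendsto_natCast_atTop_atTop
    refine this.congr_left ?_
    filter_upwards [eventually_ge_atTop c] with v hv using (Nat.cast_sub hv).symm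
  exact ((isEquivalent_choose n).comp_tendsto (tendsto_sub_atTop_nat c)).trans
    ((hsub.pow n).div .refl)

theorem isEquivalent_theta (hk : 2 * t ≤ k) (hj : j ≤ t) :
    (fun v : ℕ => theta v t k j) ~[atTop] fun v : ℕ =>
      ((k - j).choose (t - j) : ℝ) * ((v : ℝ) ^ (k - t) / (k - t).factorial) := by
  refine (IsEquivalent.refl.mul (isEquivalent_choose_sub (k - t) (t + j))).congr_left ?_
  filter_upwards [eventually_ge_atTop (2 * t)] with v hv
  rw [theta_eq hk hv hj, Nat.choose_symm_of_eq_add (show k - j = (k - t) + (t - j) by lia),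
    Nat.sub_sub]
  rfl

theorem isTheta_const_mul_pow_div_factorial {c : ℝ} (hc : c ≠ 0) (n : ℕ) :
    (fun v : ℕ => c * ((v : ℝ) ^ n / n.factorial)) =Θ[atTop] fun v : ℕ => (v : ℝ) ^ n :=
  ((isEquivalent_choose n).symm.trans_isTheta (isTheta_choose n)).const_mul_left hc

end Coverage

end JohnsonCoverage

theorem proposition4p1 (t k : ℕ) (hk : 2 * t ≤ k) :
    -- the eigenvalues of `M` and their multiplicities (algebraic and geometric)
    (∀ (V : Type*) [Fintype V] [DecidableEq V], 2 * t ≤ Fintype.card V →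
      (JohnsonCoverage.coverageMatrix V t k).charpoly =
        ∏ j ∈ Finset.range (t + 1),
          (Polynomial.X - Polynomial.C (JohnsonCoverage.theta (Fintype.card V) t k j)) ^
            JohnsonCoverage.multiplicity (Fintype.card V) j ∧
      (∀ μ : ℝ,
        Module.End.HasEigenvalue
            (Matrix.toLin' (JohnsonCoverage.coverageMatrix V t k)) μ ↔
          ∃ j ≤ t, μ = JohnsonCoverage.theta (Fintype.card V) t k j) ∧
      (∀ μ : ℝ,
        Module.finrank ℝ (Module.End.eigenspace
            (Matrix.toLin' (JohnsonCoverage.coverageMatrix V t k)) μ) =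
          ∑ j ∈ (Finset.range (t + 1)).filter
              (fun j : ℕ => JohnsonCoverage.theta (Fintype.card V) t k j = μ),
            JohnsonCoverage.multiplicity (Fintype.card V) j)) ∧
    -- the asymptotics of `θ_j`, for fixed `t`, `k`, `j` and `v → ∞`
    (∀ j ≤ t, Asymptotics.IsLittleO Filter.atTop
      (fun v : ℕ => JohnsonCoverage.theta v t k j -
        ((k - j).choose (t - j) : ℝ) * ((v : ℝ) ^ (k - t) / ((k - t).factorial : ℝ)))
      (fun v : ℕ => (v : ℝ) ^ (k - t))) ∧
    -- the `θ_j` are of order `v ^ (k - t)`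
    (∀ j ≤ t, Asymptotics.IsTheta Filter.atTop
      (fun v : ℕ => JohnsonCoverage.theta v t k j) (fun v : ℕ => (v : ℝ) ^ (k - t))) ∧
    -- for large `v`: strictly decreasing in `j`, multiplicity exactly `m_j`, least one `θ_t`
    (∃ v₀ : ℕ, 2 * t ≤ v₀ ∧
      (∀ v ≥ v₀, ∀ i j : ℕ, i < j → j ≤ t →
        JohnsonCoverage.theta v t k j < JohnsonCoverage.theta v t k i) ∧
      (∀ (V : Type*) [Fintype V] [DecidableEq V], v₀ ≤ Fintype.card V →
        (∀ j ≤ t, Module.finrank ℝ (Module.End.eigenspace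
            (Matrix.toLin' (JohnsonCoverage.coverageMatrix V t k))
            (JohnsonCoverage.theta (Fintype.card V) t k j)) =
          JohnsonCoverage.multiplicity (Fintype.card V) j) ∧
        IsLeast {μ : ℝ | Module.End.HasEigenvalue
            (Matrix.toLin' (JohnsonCoverage.coverageMatrix V t k)) μ}
          (JohnsonCoverage.theta (Fintype.card V) t k t))) := by
  have main_term (j : ℕ) (hj : j ≤ t) := JohnsonCoverage.isTheta_const_mul_pow_div_factorial
    (Nat.cast_ne_zero.mpr (Nat.choose_pos (show t - j ≤ k - j by lia)).ne') (k - t)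
  refine ⟨fun V _ _ hV => ⟨?_, ?_, ?_⟩, fun j hj => ?_, fun j hj => ?_, k + t, by lia,
    fun v hv i j hij hj => ?_, fun V _ _ hV => ⟨fun j hj => ?_, ?_⟩⟩
  · exact JohnsonCoverage.charpoly_johnsonMatrix hV (JohnsonCoverage.xi _ t k ·)
  · exact JohnsonCoverage.hasEigenvalue_johnsonMatrix_iff hV (JohnsonCoverage.xi _ t k ·)
  · exact JohnsonCoverage.finrank_eigenspace_johnsonMatrix hV (JohnsonCoverage.xi _ t k ·)
  · exact (JohnsonCoverage.isEquivalent_theta hk hj).isLittleO.trans_isTheta (main_term j hj)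
  · exact (JohnsonCoverage.isEquivalent_theta hk hj).trans_isTheta (main_term j hj)
  · exact JohnsonCoverage.strictAntiOn_theta hk hv (hij.le.trans hj) hj hij
  · exact JohnsonCoverage.finrank_eigenspace_coverageMatrix hk hV hj
  · exact JohnsonCoverage.isLeast_eigenvalue_coverageMatrix hk hV
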